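/- Let $\theta: R\to S$ be a surjective homomorphism of coherent commutative rings such that $S$ is finitely presented as an $R$-module and the ideal $\ker\theta$ is nilpotent. Let $\mathcal{U}$ be a universe containing $\mathbb{N}$ and assume that $S$ is $\mathcal{U}$-small. Let $\mathcal{D}$ be an $S$-linear abelian category and let $\mathcal{D}\to\mathcal{C}$ be a flat (nilpotent) abelian $R$-deformation of $\mathcal{D}$. That is, $\mathcal{C}$ is an $R$-linear abelian category together with an $R$-linear functor $\mathcal{D}\to\mathcal{C}$ (where $R$ acts on $\mathcal{D}$ through $\theta$) such that the induced functor $\mathcal{D}\to\mathcal{C}_S$ is an equivalence, and $\mathcal{C}$ is flat over $R$. Here $\mathcal{C}_S$ is the category of pairs $(C,\varphi)$ with $C$ an object of $\mathcal{C}$ and $\varphi: S\to \mathcal{C}(C,C)$ a ring homomorphism such that $\varphi\circ\theta$ is the given map $R\to\mathcal{C}(C,C)$, the morphisms being the morphisms of $\mathcal{C}$ that commute with the actions of $S$. The category $\mathcal{C}$ is flat over $R$ if for every finitely presented $R$-module $X$ the functor $\mathrm{Ext}^1_R(X,\mathcal{C}(-,-)):\mathcal{C}^{\mathrm{op}}\times\mathcal{C}\to\mathrm{Ab}$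 is weakly effaceable: for all $A,B\in\mathcal{C}$ and every $x\in\mathrm{Ext}^1_R(X,\mathcal{C}(A,B))$ there are an epimorphism $A'\to A$ and a monomorphism $B\to B'$ such that $x$ maps to $0$ in $\mathrm{Ext}^1_R(X,\mathcal{C}(A',B'))$. A category is a $\mathcal{U}$-category if all its Hom-sets are $\mathcal{U}$-small (of the cardinality of an element of $\mathcal{U}$), and it is essentially $\mathcal{U}$-small if it is equivalent to a category whose sets of objects and of arrows are $\mathcal{U}$-small. If $\mathcal{D}$ is a $\mathcal{U}$-category, then so is $\mathcal{C}$; and if $\mathcal{D}$ is essentially $\mathcal{U}$-small, then so is $\mathcal{C}$. -/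

import Mathlib

open CategoryTheory

universe w u₁ u₂ u₃ v₃ u₄ v₄

/-- A commutative ring is coherent if all its finitely generated ideals are finitely presented. -/
def IsCoherentRing (R : Type u₁) [CommRing R] : Prop :=
  ∀ I : Ideal R, I.FG → Module.FinitePresentation R I

namespace AbelianDef

section Flat

/-- A functor to abelian groups is weakly effaceable if every element of every value `F(A)` is
killed by `F(u)` for some monomorphism `u : A ⟶ A'`. -/
def WeaklyEffaceable {A : Type u₄} [Category.{v₄} A] (F : A ⥤ AddCommGrpCat.{w}) : Prop :=
  ∀ (X : A) (x : F.obj X), ∃ (X' : A) (u : X ⟶ X'), Mono u ∧ F.map u x = 0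

variable (R : Type u₁) [CommRing R] (C : Type u₄) [Category.{v₄} C] [Preadditive C] [Linear R C]

/-- The bifunctor `(A, B) ↦ C(A, B)` of an `R`-linear category `C`, with values in `R`-modules
(in a universe large enough to contain both `R` and the Hom-sets of `C`). -/
def homModule : Cᵒᵖ × C ⥤ ModuleCat.{max u₁ v₄} R where
  obj P := ModuleCat.of R (ULift.{u₁} (P.1.unop ⟶ P.2))
  map {P Q} f := ModuleCat.ofHom
    (ULift.moduleEquiv.symm.toLinearMap ∘ₗ
      (Linear.rightComp R Q.1.unop f.2 ∘ₗ Linear.leftComp R P.2 f.1.unop) ∘ₗ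
      ULift.moduleEquiv.toLinearMap)
  map_id P := by
    ext x
    simp
  map_comp f g := by
    ext x
    simp

/-- The `R`-linear category `C` (which will be abelian) is flat over `R` if for every finitely
presented `R`-module `X` the functor `Ext¹_R(X, C(-,-)) : Cᵒᵖ × C ⥤ Ab` is weakly effaceable. -/
def IsFlat : Prop :=
  ∀ X : ModuleCat.{max u₁ v₄} R, Module.FinitePresentation R X →
    WeaklyEffaceable (homModule R C ⋙ Abelian.extFunctorObj X 1)

end Flat

section Deformation

variable (R : Type u₁) [CommRing R] (S : Type u₂) [CommRing S] [Algebra R S]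

/-- An `S`-object of the `R`-linear category `C`: an object with a ring map from `S` to its
endomorphism ring which is compatible with the structural maps from `R`. -/
structure SObj (C : Type u₄) [Category.{v₄} C] [Preadditive C] [Linear R C] where
  /-- the underlying object -/
  obj : C
  /-- the action of `S` -/
  act : S →ₐ[R] End obj

variable {C : Type u₄} [Category.{v₄} C] [Preadditive C] [Linear R C]

/-- Morphisms of `S`-objects are the morphisms of `C` commuting with the actions of `S`. -/
@[ext]
structure SObj.Hom (X Y : SObj R S C) where
  /-- the underlying morphism -/
  hom : X.obj ⟶ Y.obj
  comm : ∀ s : S, (show X.obj ⟶ X.obj from X.act s) ≫ hom =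
    hom ≫ (show Y.obj ⟶ Y.obj from Y.act s)

/-- The category `C_S` of `S`-objects of `C`. -/
instance : Category (SObj R S C) where
  Hom X Y := SObj.Hom R S X Y
  id X := ⟨𝟙 X.obj, fun s => by simp⟩
  comp f g := ⟨f.hom ≫ g.hom, fun s => by
    rw [← Category.assoc, f.comm, Category.assoc, g.comm, Category.assoc]⟩
  id_comp f := SObj.Hom.ext (Category.id_comp f.hom)
  comp_id f := SObj.Hom.ext (Category.comp_id f.hom)
  assoc f g h := SObj.Hom.ext (Category.assoc f.hom g.hom h.hom)

variable {S} {D : Type u₃} [Category.{v₃} D] [Preadditive D] [Linear S D]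

/-- A functor `F` from an `S`-linear to an `R`-linear category is `R`-linear, where the source is
regarded as an `R`-linear category by restriction of scalars along `R → S`. -/
structure IsRLinear (F : D ⥤ C) : Prop where
  map_add : ∀ {X Y : D} (f g : X ⟶ Y), F.map (f + g) = F.map f + F.map g
  map_smul : ∀ {X Y : D} (r : R) (f : X ⟶ Y), F.map (algebraMap R S r • f) = r • F.map f

variable {R}

/-- The ring map `S → D(X, X) → C(F X, F X)` for an `R`-linear functor `F`. -/
def IsRLinear.act {F : D ⥤ C} (hF : IsRLinear R (S := S) F) (X : D) : S →ₐ[R] End (F.obj X) where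
  toFun s := F.map (s • 𝟙 X)
  map_one' := by simp [End.one_def]
  map_mul' s t := by
    rw [End.mul_def, ← F.map_comp]
    simp [mul_smul]
  map_zero' := by
    have h := hF.map_smul (0 : R) (𝟙 X)
    rwa [map_zero, zero_smul R] at h
  map_add' s t := by
    rw [add_smul]
    exact hF.map_add _ _
  commutes' r := by
    rw [hF.map_smul, F.map_id, Algebra.algebraMap_eq_smul_one]
    rfl

/-- The functor `D ⥤ C_S` induced by an `R`-linear functor `F : D ⥤ C` from an `S`-linear
category `D`. -/
def IsRLinear.induced {F : D ⥤ C} (hF : IsRLinear R (S := S) F) : D ⥤ SObj R S C where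
  obj X := ⟨F.obj X, hF.act X⟩
  map {X Y} f := ⟨F.map f, fun s => by
    change F.map (s • 𝟙 X) ≫ F.map f = F.map f ≫ F.map (s • 𝟙 Y)
    rw [← F.map_comp, ← F.map_comp]
    simp⟩
  map_id X := SObj.Hom.ext (F.map_id X)
  map_comp f g := SObj.Hom.ext (F.map_comp f g)

variable (R S C D)

/-- An (abelian) `R`-deformation `C` of the `S`-linear category `D` (both of which will be
abelian): an `R`-linear functor from `D` to `C` such that the induced functor from `D` to `C_S` is
an equivalence. -/
structure Deformation where
  /-- the functor -/
  functor : D ⥤ C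
  isRLinear : IsRLinear R (S := S) functor
  isEquivalence : isRLinear.induced.IsEquivalence

end Deformation

end AbelianDef

/-!
Call an object of `C` killed by an ideal `J` of `R` if every element of `J` acts on it as zero.
The objects of `C` killed by `I = ker (R → S)` are, up to isomorphism, the values of the functor
`D ⥤ C`, and this functor is full; so smallness of `D` passes to the objects killed by `I`. As `S`
is finitely presented over `R`, the ideal `I` is generated by finitely many elements, and these are
nilpotent. Hence `⊥` is reached from `I` by finitely many steps from `J ⊔ (y)` to `J` with
`y ^ 2 ∈ J` (`Ideal.induction_to_bot_of_isNilpotent`), and it is enough to treat one such step.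

If `E` is killed by `J`, then the image `B` and the cokernel `A` of the action of `y` on `E` are
killed by `J ⊔ (y)`, since `y ^ 2` acts as zero, and there is a short exact sequence
`0 ⟶ B ⟶ E ⟶ A ⟶ 0` through which `y` acts as `E ⟶ A ⟶ B ⟶ E` for some `t : A ⟶ B`
(`exists_shortExact_of_sq_mem`). Left exactness of `Hom` then gives the step for the size of
Hom-sets (`small_hom_of_sq_mem`).

For the set of isomorphism classes, fix `A`, `B` and `t`. Two extensions `E₁`, `E₂` of `A` by `B`
with the same `t` have a Baer difference `Q`, the quotient of `E₁ ×_A E₂` by the diagonal copy of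
`B`. The element `y` acts as zero on `Q`, so that `Q` is again killed by `J ⊔ (y)`
(`le_annihilator_baerDiff`). Conversely `E₂` is the Baer difference of `E₁` and `Q`: it is the
cokernel of a morphism from `B` to the kernel of a morphism `E₁ ⊞ Q ⟶ A`
(`exists_iso_cokernel_of_shortExact`). Fixing one `E₁` for each `(A, B, t)` bounds the isomorphism
classes of the objects killed by `J` (`essentiallySmall_killedBy_of_sq_mem`).
-/

namespace AbelianDef

open CategoryTheory Limits

/-! ### Reduction from a nilpotent ideal to square-zero steps -/

/-- Descent along a principal ideal with nilpotent generator, by successive squaring of the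
generator. -/
lemma _root_.Ideal.of_sup_span_singleton_of_isNilpotent {R : Type*} [CommRing R]
    {P : Ideal R → Prop}
    (step : ∀ (J : Ideal R) (y : R), y ^ 2 ∈ J → P (J ⊔ Ideal.span {y}) → P J)
    {x : R} (hx : IsNilpotent x) (J : Ideal R) (h : P (J ⊔ Ideal.span {x})) : P J := by
  have key : ∀ k : ℕ, P (J ⊔ Ideal.span {x ^ 2 ^ k}) := by
    intro k
    induction k with
    | zero => simpa using h
    | succ k ih =>
      have hmem : (x ^ 2 ^ k) ^ 2 ∈ J ⊔ Ideal.span {x ^ 2 ^ (k + 1)} := by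
        rw [← pow_mul, ← pow_succ]
        exact Ideal.mem_sup_right (Ideal.mem_span_singleton_self _)
      refine step _ (x ^ 2 ^ k) hmem ?_
      have hle : Ideal.span {x ^ 2 ^ (k + 1)} ≤ Ideal.span {x ^ 2 ^ k} := by
        rw [Ideal.span_singleton_le_span_singleton]
        exact pow_dvd_pow _ (Nat.pow_le_pow_right two_pos k.le_succ)
      rwa [sup_assoc, sup_eq_right.2 hle]
  obtain ⟨n, hn⟩ := hx
  have h0 : x ^ 2 ^ n = 0 := pow_eq_zero_of_le Nat.lt_two_pow_self.le hn
  have := key n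
  rwa [h0, Ideal.span_singleton_eq_bot.2 rfl, sup_bot_eq] at this

/-- A property of ideals that descends from `J ⊔ (y)` to `J` whenever `y ^ 2 ∈ J` descends from a
finitely generated nilpotent ideal to the zero ideal. -/
lemma _root_.Ideal.induction_to_bot_of_isNilpotent {R : Type*} [CommRing R] {P : Ideal R → Prop}
    (step : ∀ (J : Ideal R) (y : R), y ^ 2 ∈ J → P (J ⊔ Ideal.span {y}) → P J)
    {I : Ideal R} (hfg : I.FG) (hI : IsNilpotent I) (h : P I) : P ⊥ := by
  classical
  obtain ⟨s, rfl⟩ := hfg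
  have hs : ∀ x ∈ s, IsNilpotent x := by
    obtain ⟨n, hn⟩ := hI
    intro x hx
    refine ⟨n, ?_⟩
    have := Ideal.pow_mem_pow (Ideal.subset_span (Finset.mem_coe.2 hx)) n
    rwa [hn] at this
  have key : ∀ (s : Finset R), (∀ x ∈ s, IsNilpotent x) →
      ∀ J : Ideal R, P (J ⊔ Ideal.span (s : Set R)) → P J := by
    intro s
    induction s using Finset.induction_on with
    | empty => intro _ J hJ; simpa using hJ
    | insert a s _ ih =>
      intro hs J hJ
      refine Ideal.of_sup_span_singleton_of_isNilpotent step (hs a (Finset.mem_insert_self a s))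
        J (ih (fun x hx => hs x (Finset.mem_insert_of_mem hx)) _ ?_)
      rwa [sup_assoc, ← Ideal.span_insert, ← Finset.coe_insert]
  exact key s hs ⊥ (by rwa [bot_sup_eq])

/-! ### Objects killed by an ideal -/

section Annihilator

variable (R : Type u₁) [CommRing R] {C : Type u₄} [Category.{v₄} C] [Preadditive C] [Linear R C]

/-- The annihilator of an object of an `R`-linear category: the ideal of all elements of `R` that
act on it as zero. -/
def annihilator (X : C) : Ideal R := RingHom.ker (algebraMap R (End X))

/-- The property of being killed by an ideal. -/
def killedBy (J : Ideal R) : ObjectProperty C := fun X => J ≤ annihilator R X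

variable {R}

lemma mem_annihilator_iff {X : C} {r : R} : r ∈ annihilator R X ↔ r • 𝟙 X = 0 := by
  rw [annihilator, RingHom.mem_ker, Algebra.algebraMap_eq_smul_one]
  rfl

lemma annihilator_le_of_mono {X Y : C} (f : X ⟶ Y) [Mono f] :
    annihilator R Y ≤ annihilator R X := by
  intro r hr
  rw [mem_annihilator_iff] at hr ⊢
  rw [← cancel_mono f, Linear.smul_comp, Category.id_comp, zero_comp, ← Category.comp_id f,
    ← Linear.comp_smul, hr, comp_zero]

lemma annihilator_le_of_epi {X Y : C} (f : X ⟶ Y) [Epi f] :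
    annihilator R X ≤ annihilator R Y := by
  intro r hr
  rw [mem_annihilator_iff] at hr ⊢
  rw [← cancel_epi f, Linear.comp_smul, Category.comp_id, comp_zero, ← Category.id_comp f,
    ← Linear.smul_comp, hr, zero_comp]

end Annihilator

/-! ### Extensions and their Baer difference -/

section Extension

variable {C : Type u₄} [Category.{v₄} C] [Abelian C] {A B E₁ E₂ : C}
  {i₁ : B ⟶ E₁} {p₁ : E₁ ⟶ A} {w₁ : i₁ ≫ p₁ = 0} {i₂ : B ⟶ E₂} {p₂ : E₂ ⟶ A} {w₂ : i₂ ≫ p₂ = 0}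

/-- The diagonal morphism `B ⟶ E₁ ×_A E₂` of two extensions of `A` by `B`. -/
noncomputable def baerDiag (w₁ : i₁ ≫ p₁ = 0) (w₂ : i₂ ≫ p₂ = 0) : B ⟶ pullback p₁ p₂ :=
  pullback.lift i₁ i₂ (by rw [w₁, w₂])

lemma baerDiag_fst (w₁ : i₁ ≫ p₁ = 0) (w₂ : i₂ ≫ p₂ = 0) :
    baerDiag w₁ w₂ ≫ pullback.fst p₁ p₂ = i₁ :=
  pullback.lift_fst _ _ _

lemma baerDiag_snd (w₁ : i₁ ≫ p₁ = 0) (w₂ : i₂ ≫ p₂ = 0) :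
    baerDiag w₁ w₂ ≫ pullback.snd p₁ p₂ = i₂ :=
  pullback.lift_snd _ _ _

/-- The Baer difference of two extensions of `A` by `B`: the quotient of `E₁ ×_A E₂` by the
diagonal copy of `B`. -/
noncomputable def baerDiff (w₁ : i₁ ≫ p₁ = 0) (w₂ : i₂ ≫ p₂ = 0) : C :=
  cokernel (baerDiag w₁ w₂)

/-- The projection from `E₁ ×_A E₂` to the Baer difference. -/
noncomputable def toBaerDiff (w₁ : i₁ ≫ p₁ = 0) (w₂ : i₂ ≫ p₂ = 0) :
    pullback p₁ p₂ ⟶ baerDiff w₁ w₂ :=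
  cokernel.π (baerDiag w₁ w₂)

instance : Epi (toBaerDiff w₁ w₂) := inferInstanceAs (Epi (cokernel.π _))

/-- The projection from the Baer difference of two extensions of `A` to `A`. -/
noncomputable def baerDiffProj (w₁ : i₁ ≫ p₁ = 0) (w₂ : i₂ ≫ p₂ = 0) : baerDiff w₁ w₂ ⟶ A :=
  cokernel.desc (baerDiag w₁ w₂) (pullback.fst p₁ p₂ ≫ p₁)
    (by rw [reassoc_of% baerDiag_fst w₁ w₂, w₁])

lemma baerDiag_toBaerDiff (w₁ : i₁ ≫ p₁ = 0) (w₂ : i₂ ≫ p₂ = 0) :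
    baerDiag w₁ w₂ ≫ toBaerDiff w₁ w₂ = 0 :=
  cokernel.condition _

lemma toBaerDiff_proj (w₁ : i₁ ≫ p₁ = 0) (w₂ : i₂ ≫ p₂ = 0) :
    toBaerDiff w₁ w₂ ≫ baerDiffProj w₁ w₂ = pullback.fst p₁ p₂ ≫ p₁ :=
  cokernel.π_desc _ _ _

/-- Pushing the cokernel of `baerDiag` out along the first projection gives the cokernel of
`baerDiag ≫ pullback.fst = i₁`, which is `p₁`. -/
lemma isPushout_baerDiff (h₁ : (ShortComplex.mk i₁ p₁ w₁).ShortExact) :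
    IsPushout (pullback.fst p₁ p₂) (toBaerDiff w₁ w₂) p₁ (baerDiffProj w₁ w₂) := by
  have : Epi p₁ := h₁.epi_g
  have hw (s : PushoutCocone (pullback.fst p₁ p₂) (toBaerDiff w₁ w₂)) : i₁ ≫ s.inl = 0 := by
    have h := baerDiag w₁ w₂ ≫= s.condition
    rwa [reassoc_of% baerDiag_fst w₁ w₂, reassoc_of% baerDiag_toBaerDiff w₁ w₂,
      zero_comp] at h
  have hfac (s : PushoutCocone (pullback.fst p₁ p₂) (toBaerDiff w₁ w₂)) :
      p₁ ≫ h₁.gIsCokernel.desc (CokernelCofork.ofπ s.inl (hw s)) = s.inl :=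
    h₁.gIsCokernel.fac (CokernelCofork.ofπ s.inl (hw s)) WalkingParallelPair.one
  refine IsPushout.mk ⟨(toBaerDiff_proj w₁ w₂).symm⟩ ⟨PushoutCocone.IsColimit.mk _
    (fun s => h₁.gIsCokernel.desc (CokernelCofork.ofπ s.inl (hw s))) hfac (fun s => ?_)
    (fun s m hm _ => ?_)⟩
  · rw [← cancel_epi (toBaerDiff w₁ w₂), ← s.condition,
      reassoc_of% toBaerDiff_proj w₁ w₂, hfac]
  · rw [← cancel_epi p₁, hm, hfac]

/-- An extension `E₂` of `A` by `B` is recovered from another such extension `E₁` and the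
Baer difference `Q` of the two: it is the quotient of `E₁ ×_A Q` by a copy of `B`. -/
lemma exists_iso_cokernel_of_shortExact (h₁ : (ShortComplex.mk i₁ p₁ w₁).ShortExact)
    (h₂ : (ShortComplex.mk i₂ p₂ w₂).ShortExact) :
    ∃ (f : E₁ ⊞ baerDiff w₁ w₂ ⟶ A) (g : B ⟶ kernel f), Nonempty (E₂ ≅ cokernel g) := by
  have : Epi p₁ := h₁.epi_g
  have : Mono i₁ := h₁.mono_f
  have : Epi p₂ := h₂.epi_g
  have sq := isPushout_baerDiff (w₂ := w₂) h₁
  have hmono : Mono sq.shortComplex.f := by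
    refine Preadditive.mono_of_cancel_zero _ (fun {T} (x : T ⟶ pullback p₁ p₂)
      (hx : x ≫ biprod.lift (pullback.fst p₁ p₂) (-toBaerDiff w₁ w₂) = 0) => ?_)
    change x = (0 : T ⟶ pullback p₁ p₂)
    have hx₁ : x ≫ pullback.fst p₁ p₂ = 0 := by
      have := hx =≫ biprod.fst
      rwa [Category.assoc, biprod.lift_fst, zero_comp] at this
    have hx₂ : x ≫ toBaerDiff w₁ w₂ = 0 := by
      have := hx =≫ biprod.snd
      rwa [Category.assoc, biprod.lift_snd, Preadditive.comp_neg, zero_comp,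
        neg_eq_zero] at this
    -- The kernel of the second map is the diagonal copy of `B`, which embeds into `E₁`.
    obtain ⟨T', q, _, (b : T' ⟶ B), (hb : q ≫ x = b ≫ baerDiag w₁ w₂)⟩ :=
      (ShortComplex.exact_cokernel (baerDiag w₁ w₂)).exact_up_to_refinements x hx₂
    have hb0 : b = 0 := by
      rw [← cancel_mono i₁, zero_comp, ← baerDiag_fst w₁ w₂, ← reassoc_of% hb, hx₁, comp_zero]
    rw [← cancel_epi q, hb, hb0, zero_comp, comp_zero]
  let e : pullback p₁ p₂ ≅ kernel sq.shortComplex.g :=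
    IsLimit.conePointUniqueUpToIso sq.exact_shortComplex.fIsKernel (limit.isLimit _)
  let j : B ⟶ pullback p₁ p₂ := pullback.lift i₁ 0 (by rw [w₁, zero_comp])
  have fj : j ≫ pullback.fst p₁ p₂ = i₁ := pullback.lift_fst _ _ _
  have wj : j ≫ pullback.snd p₁ p₂ = 0 := pullback.lift_snd _ _ _
  have hj : (ShortComplex.mk j (pullback.snd p₁ p₂) wj).Exact := by
    rw [ShortComplex.exact_iff_exact_up_to_refinements]
    intro T x hx
    dsimp at x hx
    have hx₁ : (x ≫ pullback.fst p₁ p₂) ≫ p₁ = 0 := by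
      rw [Category.assoc, pullback.condition, reassoc_of% hx, zero_comp]
    obtain ⟨T', q, _, (b : T' ⟶ B), (hb : q ≫ x ≫ _ = b ≫ i₁)⟩ := h₁.exact.exact_up_to_refinements _ hx₁
    refine ⟨T', q, inferInstance, b, pullback.hom_ext ?_ ?_⟩
    · rw [Category.assoc, Category.assoc, fj, hb]
    · rw [Category.assoc, Category.assoc, wj, hx, comp_zero, comp_zero]
  let e₂ : E₂ ≅ cokernel j :=
    IsColimit.coconePointUniqueUpToIso hj.gIsCokernel (colimit.isColimit _)
  exact ⟨sq.shortComplex.g, j ≫ e.hom, ⟨e₂ ≪≫ (cokernelCompIsIso j e.hom).symm⟩⟩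

/-- If `y` acts on two extensions of `A` by `B` through the same morphism `t : A ⟶ B`, then it acts
as zero on their Baer difference. -/
lemma le_annihilator_baerDiff {R : Type u₁} [CommRing R] [Linear R C] {J : Ideal R} {y : R}
    {t : A ⟶ B} (w₁ : i₁ ≫ p₁ = 0) (w₂ : i₂ ≫ p₂ = 0)
    (hJ₁ : J ≤ annihilator R E₁) (hJ₂ : J ≤ annihilator R E₂)
    (hy₁ : y • 𝟙 E₁ = p₁ ≫ t ≫ i₁) (hy₂ : y • 𝟙 E₂ = p₂ ≫ t ≫ i₂) :
    J ⊔ Ideal.span {y} ≤ annihilator R (baerDiff w₁ w₂) := by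
  have hsmul : ∀ r : R, r • 𝟙 (pullback p₁ p₂) ≫ pullback.fst p₁ p₂ =
      pullback.fst p₁ p₂ ≫ (r • 𝟙 E₁) := by simp
  have hsmul' : ∀ r : R, r • 𝟙 (pullback p₁ p₂) ≫ pullback.snd p₁ p₂ =
      pullback.snd p₁ p₂ ≫ (r • 𝟙 E₂) := by simp
  refine sup_le (le_trans (fun r hr => ?_) (annihilator_le_of_epi (toBaerDiff w₁ w₂))) ?_
  · rw [mem_annihilator_iff]
    refine pullback.hom_ext ?_ ?_
    · rw [Linear.smul_comp, hsmul, mem_annihilator_iff.1 (hJ₁ hr), comp_zero, zero_comp]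
    · rw [Linear.smul_comp, hsmul', mem_annihilator_iff.1 (hJ₂ hr), comp_zero, zero_comp]
  · rw [Ideal.span_singleton_le_iff_mem, mem_annihilator_iff]
    have hy : y • 𝟙 (pullback p₁ p₂) = (pullback.fst p₁ p₂ ≫ p₁ ≫ t) ≫ baerDiag w₁ w₂ := by
      refine pullback.hom_ext ?_ ?_
      · rw [Linear.smul_comp, hsmul, hy₁]
        simp only [Category.assoc, baerDiag_fst]
      · rw [Linear.smul_comp, hsmul', hy₂]
        simp only [Category.assoc, baerDiag_snd, pullback.condition_assoc]
    rw [← cancel_epi (toBaerDiff w₁ w₂), comp_zero, Linear.comp_smul, Category.comp_id,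
      ← Category.id_comp (toBaerDiff w₁ w₂), ← Linear.smul_comp, hy, Category.assoc,
      baerDiag_toBaerDiff, comp_zero]

end Extension

/-! ### The square-zero step -/

section Step

variable {R : Type u₁} [CommRing R] {C : Type u₄} [Category.{v₄} C] [Abelian C] [Linear R C]

/-- The short exact sequence formed by the image and the cokernel of the action of `y`. -/
lemma exists_shortExact_of_sq_mem {J : Ideal R} {y : R} (hy : y ^ 2 ∈ J) {E : C}
    (hE : killedBy R J E) :
    ∃ (A B : C) (i : B ⟶ E) (p : E ⟶ A) (w : i ≫ p = 0) (t : A ⟶ B),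
      killedBy R (J ⊔ Ideal.span {y}) A ∧ killedBy R (J ⊔ Ideal.span {y}) B ∧
      (ShortComplex.mk i p w).ShortExact ∧ y • 𝟙 E = p ≫ t ≫ i := by
  let m : E ⟶ E := y • 𝟙 E
  have hm : m ≫ m = 0 := by
    have h := mem_annihilator_iff.1 (hE hy)
    simpa [m, smul_smul, ← pow_two] using h
  have hfac : Abelian.factorThruImage m ≫ Abelian.image.ι m = m := Abelian.image.fac m
  have hm' : m ≫ Abelian.factorThruImage m = 0 := by
    rw [← cancel_mono (Abelian.image.ι m), Category.assoc, hfac, hm, zero_comp]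
  refine ⟨cokernel m, Abelian.image m, Abelian.image.ι m, cokernel.π m,
    kernel.condition _, cokernel.desc m (Abelian.factorThruImage m) hm', ?_, ?_, ?_, ?_⟩
  · refine sup_le (hE.trans (annihilator_le_of_epi (cokernel.π m))) ?_
    rw [Ideal.span_singleton_le_iff_mem, mem_annihilator_iff, ← cancel_epi (cokernel.π m),
      comp_zero, ← cokernel.condition m, Linear.comp_smul, Category.comp_id, Linear.smul_comp,
      Category.id_comp]
  · refine sup_le (hE.trans (annihilator_le_of_mono (Abelian.image.ι m))) ?_
    rw [Ideal.span_singleton_le_iff_mem, mem_annihilator_iff,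
      ← cancel_epi (Abelian.factorThruImage m), comp_zero, ← hm']
    simp [m]
  · exact { exact := ShortComplex.exact_kernel (cokernel.π m)
            mono_f := inferInstanceAs (Mono (kernel.ι _))
            epi_g := inferInstanceAs (Epi (cokernel.π m)) }
  · rw [cokernel.π_desc_assoc, hfac]

/-- Left exactness of `Hom(-, X)` makes smallness of the Hom-sets to `X` stable under extensions. -/
lemma small_hom_to_of_exact {A B E : C} {i : B ⟶ E} {p : E ⟶ A} {w : i ≫ p = 0}
    (h : (ShortComplex.mk i p w).ShortExact) (X : C) [Small.{w} (A ⟶ X)] [Small.{w} (B ⟶ X)] :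
    Small.{w} (E ⟶ X) := by
  let ρ : (E ⟶ X) → (B ⟶ X) := fun f => i ≫ f
  refine small_of_surjective.{w} (α := Set.range ρ × (A ⟶ X))
    (f := fun u => u.1.2.choose + p ≫ u.2) (fun f => ?_)
  let f₀ : E ⟶ X := (⟨f, rfl⟩ : ρ f ∈ Set.range ρ).choose
  have hf₀ : i ≫ f₀ = i ≫ f := (⟨f, rfl⟩ : ρ f ∈ Set.range ρ).choose_spec
  have hd : i ≫ (f - f₀) = 0 := by rw [Preadditive.comp_sub, hf₀, sub_self]
  refine ⟨⟨⟨ρ f, f, rfl⟩, h.gIsCokernel.desc (CokernelCofork.ofπ (f - f₀) hd)⟩, ?_⟩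
  have : p ≫ h.gIsCokernel.desc (CokernelCofork.ofπ (f - f₀) hd) = f - f₀ :=
    h.gIsCokernel.fac _ WalkingParallelPair.one
  change f₀ + p ≫ _ = f
  rw [this, add_sub_cancel]

/-- Left exactness of `Hom(X, -)` makes smallness of the Hom-sets from `X` stable under
extensions. -/
lemma small_hom_from_of_exact {A B E : C} {i : B ⟶ E} {p : E ⟶ A} {w : i ≫ p = 0}
    (h : (ShortComplex.mk i p w).ShortExact) (X : C) [Small.{w} (X ⟶ A)] [Small.{w} (X ⟶ B)] :
    Small.{w} (X ⟶ E) := by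
  let ρ : (X ⟶ E) → (X ⟶ A) := fun f => f ≫ p
  refine small_of_surjective.{w} (α := Set.range ρ × (X ⟶ B))
    (f := fun u => u.1.2.choose + u.2 ≫ i) (fun f => ?_)
  let f₀ : X ⟶ E := (⟨f, rfl⟩ : ρ f ∈ Set.range ρ).choose
  have hf₀ : f₀ ≫ p = f ≫ p := (⟨f, rfl⟩ : ρ f ∈ Set.range ρ).choose_spec
  have hd : (f - f₀) ≫ p = 0 := by rw [Preadditive.sub_comp, hf₀, sub_self]
  refine ⟨⟨⟨ρ f, f, rfl⟩, h.fIsKernel.lift (KernelFork.ofι (f - f₀) hd)⟩, ?_⟩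
  have : h.fIsKernel.lift (KernelFork.ofι (f - f₀) hd) ≫ i = f - f₀ :=
    h.fIsKernel.fac _ WalkingParallelPair.zero
  change f₀ + _ ≫ i = f
  rw [this, add_sub_cancel]

lemma small_hom_of_sq_mem {J : Ideal R} {y : R} (hy : y ^ 2 ∈ J)
    (h : ∀ X Y : C, killedBy R (J ⊔ Ideal.span {y}) X → killedBy R (J ⊔ Ideal.span {y}) Y →
      Small.{w} (X ⟶ Y))
    (X Y : C) (hX : killedBy R J X) (hY : killedBy R J Y) : Small.{w} (X ⟶ Y) := by
  obtain ⟨A, B, i, p, w, _, hA, hB, hS, _⟩ := exists_shortExact_of_sq_mem hy hX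
  obtain ⟨A', B', i', p', w', _, hA', hB', hS', _⟩ := exists_shortExact_of_sq_mem hy hY
  have := h A A' hA hA'
  have := h A B' hA hB'
  have := h B A' hB hA'
  have := h B B' hB hB'
  have := small_hom_from_of_exact hS' A
  have := small_hom_from_of_exact hS' B
  exact small_hom_to_of_exact hS Y

/-- `E` is an extension of `A` by `B` that is killed by `J`, and `y` acts on `E` through
`t : A ⟶ B`. -/
def IsExtensionVia (J : Ideal R) (y : R) {A B : C} (t : A ⟶ B) (E : C) : Prop :=
  killedBy R J E ∧ ∃ (i : B ⟶ E) (p : E ⟶ A) (w : i ≫ p = 0),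
    (ShortComplex.mk i p w).ShortExact ∧ y • 𝟙 E = p ≫ t ≫ i

lemma IsExtensionVia.exists_iso {J : Ideal R} {y : R} {A A' B B' : C} {t : A ⟶ B} {E : C}
    (h : IsExtensionVia J y t E) (a : A ≅ A') (b : B ≅ B') :
    IsExtensionVia J y (a.inv ≫ t ≫ b.hom) E := by
  obtain ⟨hE, i, p, w, hS, hy⟩ := h
  refine ⟨hE, b.inv ≫ i, p ≫ a.hom, by simp [reassoc_of% w], ?_, by simp [hy]⟩
  exact ShortComplex.shortExact_of_iso
    (ShortComplex.isoMk b (Iso.refl E) a (by simp) (by simp)) hS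

/-- Among the extensions of `A` by `B` on which `y` acts through a fixed `t`, any two differ by an
object killed by `J ⊔ (y)`. -/
lemma IsExtensionVia.exists_iso_cokernel {J : Ideal R} {y : R} {A B : C} {t : A ⟶ B} {E₁ E₂ : C}
    (h₁ : IsExtensionVia J y t E₁) (h₂ : IsExtensionVia J y t E₂) :
    ∃ (Q : C) (_ : killedBy R (J ⊔ Ideal.span {y}) Q) (f : E₁ ⊞ Q ⟶ A) (g : B ⟶ kernel f),
      Nonempty (E₂ ≅ cokernel g) := by
  obtain ⟨hE₁, i₁, p₁, w₁, hS₁, hy₁⟩ := h₁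
  obtain ⟨hE₂, i₂, p₂, w₂, hS₂, hy₂⟩ := h₂
  exact ⟨baerDiff w₁ w₂, le_annihilator_baerDiff w₁ w₂ hE₁ hE₂ hy₁ hy₂,
    exists_iso_cokernel_of_shortExact hS₁ hS₂⟩

lemma essentiallySmall_killedBy_of_sq_mem [LocallySmall.{w} C] {J : Ideal R} {y : R}
    (hy : y ^ 2 ∈ J)
    (h : ObjectProperty.EssentiallySmall.{w} (killedBy R (C := C) (J ⊔ Ideal.span {y}))) :
    ObjectProperty.EssentiallySmall.{w} (killedBy R (C := C) J) := by
  obtain ⟨P, _, hP⟩ := h.exists_small_le'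
  -- The types `(A, B, t)` of extensions that occur, and one chosen extension of each type.
  let T : Type _ := { τ : Σ (A B : Subtype P), (A.1 ⟶ B.1) // ∃ E, IsExtensionVia J y τ.2.2 E }
  let E₁ : T → C := fun τ => τ.2.choose
  have hE₁ (τ : T) : IsExtensionVia J y τ.1.2.2 (E₁ τ) := τ.2.choose_spec
  let K : Type _ := Σ (τ : T) (Q : Subtype P) (f : E₁ τ ⊞ Q.1 ⟶ τ.1.1.1), τ.1.2.1.1 ⟶ kernel f
  let X : K → C := fun k => cokernel k.2.2.2
  refine ⟨ObjectProperty.ofObj X, inferInstance, fun E hE => ?_⟩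
  obtain ⟨A, B, i, p, w, t, hA, hB, hS, ht⟩ := exists_shortExact_of_sq_mem hy hE
  obtain ⟨A', hA', ⟨a⟩⟩ := hP A hA
  obtain ⟨B', hB', ⟨b⟩⟩ := hP B hB
  have hvia : IsExtensionVia J y (a.inv ≫ t ≫ b.hom) E :=
    IsExtensionVia.exists_iso ⟨hE, i, p, w, hS, ht⟩ a b
  let τ : T := ⟨⟨⟨A', hA'⟩, ⟨B', hB'⟩, a.inv ≫ t ≫ b.hom⟩, E, hvia⟩
  obtain ⟨Q, hQ, f, g, ⟨e⟩⟩ := (hE₁ τ).exists_iso_cokernel hvia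
  obtain ⟨Q', hQ', ⟨q⟩⟩ := hP Q hQ
  -- `Q` is replaced by the isomorphic object `Q'` of the small family.
  let s : E₁ τ ⊞ Q' ≅ E₁ τ ⊞ Q := biprod.mapIso (Iso.refl _) q.symm
  let κ : kernel f ≅ kernel (s.hom ≫ f) := (kernelIsIsoComp s.hom f).symm
  exact ⟨_, ⟨(⟨τ, ⟨Q', hQ'⟩, s.hom ≫ f, g ≫ κ.hom⟩ : K)⟩,
    ⟨e ≪≫ (cokernelCompIsIso g κ.hom).symm⟩⟩

end Step

/-! ### Objects killed by the kernel of `R → S` -/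

section Base

variable {R : Type u₁} [CommRing R] {S : Type u₂} [CommRing S] [Algebra R S]
  {D : Type u₃} [Category.{v₃} D] [Preadditive D] [Linear S D]
  {C : Type u₄} [Category.{v₄} C] [Preadditive C] [Linear R C]

/-- An object killed by the kernel of the surjection `R → S` carries an action of `S`. -/
noncomputable def SObj.ofKilledBy (hsurj : Function.Surjective (algebraMap R S)) (X : C)
    (hX : killedBy R (RingHom.ker (algebraMap R S)) X) : SObj R S C where
  obj := X
  act := (Ideal.Quotient.liftₐ (RingHom.ker (Algebra.ofId R S)) (Algebra.ofId R (End X))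
      (fun _ hr => hX hr)).comp
    (Ideal.quotientKerAlgEquivOfSurjective (f := Algebra.ofId R S) hsurj).symm.toAlgHom

lemma Deformation.exists_iso_obj (F : Deformation R S C D)
    (hsurj : Function.Surjective (algebraMap R S)) (X : C)
    (hX : killedBy R (RingHom.ker (algebraMap R S)) X) :
    ∃ d : D, Nonempty (F.functor.obj d ≅ X) := by
  have := F.isEquivalence
  let e := F.isRLinear.induced.objObjPreimageIso (SObj.ofKilledBy hsurj X hX)
  exact ⟨_, ⟨{ hom := e.hom.hom
               inv := e.inv.hom
               hom_inv_id := congrArg SObj.Hom.hom e.hom_inv_id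
               inv_hom_id := congrArg SObj.Hom.hom e.inv_hom_id }⟩⟩

/-- As `R → S` is surjective, every morphism of `C` between `S`-objects commutes with the actions
of `S`. -/
lemma Deformation.map_surjective (F : Deformation R S C D)
    (hsurj : Function.Surjective (algebraMap R S)) (d d' : D) :
    Function.Surjective (F.functor.map : (d ⟶ d') → _) := by
  have := F.isEquivalence
  intro f
  let f' : F.isRLinear.induced.obj d ⟶ F.isRLinear.induced.obj d' := ⟨f, fun s => by
    obtain ⟨r, rfl⟩ := hsurj s
    rw [AlgHom.commutes, AlgHom.commutes, Algebra.algebraMap_eq_smul_one,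
      Algebra.algebraMap_eq_smul_one]
    change (r • 𝟙 (F.functor.obj d)) ≫ f = f ≫ (r • 𝟙 (F.functor.obj d'))
    simp⟩
  obtain ⟨g, hg⟩ := F.isRLinear.induced.map_surjective f'
  exact ⟨g, congrArg SObj.Hom.hom hg⟩

lemma Deformation.small_hom_of_killedBy_ker [LocallySmall.{w} D] (F : Deformation R S C D)
    (hsurj : Function.Surjective (algebraMap R S)) (X Y : C)
    (hX : killedBy R (RingHom.ker (algebraMap R S)) X)
    (hY : killedBy R (RingHom.ker (algebraMap R S)) Y) : Small.{w} (X ⟶ Y) := by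
  obtain ⟨d, ⟨a⟩⟩ := F.exists_iso_obj hsurj X hX
  obtain ⟨d', ⟨b⟩⟩ := F.exists_iso_obj hsurj Y hY
  have : Small.{w} (F.functor.obj d ⟶ F.functor.obj d') :=
    small_of_surjective (F.map_surjective hsurj d d')
  exact small_of_surjective (a.homCongr b).surjective

lemma Deformation.essentiallySmall_killedBy_ker [EssentiallySmall.{w} D]
    (F : Deformation R S C D) (hsurj : Function.Surjective (algebraMap R S)) :
    ObjectProperty.EssentiallySmall.{w}
      (killedBy R (C := C) (RingHom.ker (algebraMap R S))) :=
  ObjectProperty.EssentiallySmall.of_le (Q := F.functor.essImage)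
    (fun X hX => F.exists_iso_obj hsurj X hX)

end Base

end AbelianDef

open AbelianDef in
theorem proposition6p9
    {R : Type u₁} [CommRing R] {S : Type u₂} [CommRing S] [Algebra R S]
    (hR : IsCoherentRing R) (hS : IsCoherentRing S)
    (hfp : Module.FinitePresentation R S)
    (hsurj : Function.Surjective (algebraMap R S))
    (hnil : IsNilpotent (RingHom.ker (algebraMap R S)))
    (hsmall : Small.{w} S)
    {D : Type u₃} [Category.{v₃} D] [Abelian D] [Linear S D]
    {C : Type u₄} [Category.{v₄} C] [Abelian C] [Linear R C]
    (F : AbelianDef.Deformation R S C D)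
    (hflat : AbelianDef.IsFlat R C) :
    (LocallySmall.{w} D → LocallySmall.{w} C) ∧
      (EssentiallySmall.{w} D → EssentiallySmall.{w} C) := by
  have hfg : (RingHom.ker (algebraMap R S)).FG :=
    Module.FinitePresentation.fg_ker (Algebra.linearMap R S) hsurj
  have hloc : LocallySmall.{w} D → LocallySmall.{w} C := fun _ => ⟨fun X Y =>
    Ideal.induction_to_bot_of_isNilpotent
      (P := fun J => ∀ X Y : C, killedBy R J X → killedBy R J Y → Small.{w} (X ⟶ Y))
      (fun _ _ hy h => small_hom_of_sq_mem hy h) hfg hnil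
      (F.small_hom_of_killedBy_ker hsurj) X Y bot_le bot_le⟩
  refine ⟨hloc, fun _ => ?_⟩
  have := hloc inferInstance
  rw [essentiallySmall_iff_objectPropertyEssentiallySmall_top]
  have := Ideal.induction_to_bot_of_isNilpotent
    (P := fun J => ObjectProperty.EssentiallySmall.{w} (killedBy R (C := C) J))
    (fun _ _ hy h => essentiallySmall_killedBy_of_sq_mem hy h) hfg hnil
    (F.essentiallySmall_killedBy_ker hsurj)
  exact ObjectProperty.EssentiallySmall.of_le (Q := killedBy R (C := C) ⊥) (fun _ _ => bot_le)
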